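/- **Setting.** Let $d\ge 1$ and let the action set be the hypercube $\mathcal A=[-1,1]^d$. A user has an unknown preference parameter $\theta_*\in\mathbb R^d$. In each round $t=1,2,\dots$ a system algorithm $\mathcal G$ recommends a pair $(a_{0,t},a_{1,t})\in\mathcal A^2$; the user chooses one of the two arms, denoted $a_t$, and observes the reward $r_t=\theta_*^\top a_t+\eta_t$, where the noises $\eta_t$ are independent standard Gaussian variables. The (possibly randomized) algorithm $\mathcal G$ sees only which of the two recommended arms was chosen in each past round. The user has a positive definite prior matrix $V_0$; before round $t$ she computes an estimate $\theta_t=F(\mathcal H_{t-1})$, where $F$ is a fixed (measurable) learning rule and $\mathcal H_{t-1}=\{(a_s,r_s)\}_{s<t}$, and she chooses $a_t$ as an arm with the largest index $\hat r_i=\theta_t^\top a_{i,t}+\beta^{(i)}_t\|a_{i,t}\|_{V_t^{-1}}$, $i\in\{0,1\}$, where $V_t=V_0+\sum_{s<t}a_sa_s^\top$ and $\|x\|_M=\sqrt{x^\top Mx}$. Ties are broken arbitrarily; the coefficients $\beta_t^{(i)}$ are arbitrary and both they and the tie-breaking may depend on $\mathcal H_{t-1}$ and on the offered pair, but the user's rule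 does not depend on $\theta_*$. For $c,\gamma>0$ the user is called *$(c,\gamma)$-rational* if there are constants $c_1,c_2\in[0,c]$, $\gamma_1,\gamma_2\in[0,\tfrac12)$ with $\max\{\gamma_1,\gamma_2\}\le\gamma$, and a function $g$, such that $|\beta_t^{(i)}|\le c_2t^{\gamma_2}$ for all $t$ and $i$, and such that for every $\theta_*$ with $\|\theta_*\|_1=1$, every system algorithm, every $t$ and every $\delta\in(0,1)$ the bound $\|\theta_*-\theta_t\|_{V_t}\le c_1t^{\gamma_1}g(\delta)$ holds with probability at least $1-\delta$. **Theorem 3.** For every $\gamma>0$ there is a function $T_0(d)>0$ such that for all $d\ge 1$ and $c>0$ the following hold. 1. There exists a $(c,\gamma)$-rational user. 2. For every $(c,\gamma)$-rational user, every $T>T_0(d)$ and every system algorithm $\mathcal G$ (which may depend on $T$ and on the user), there is $\theta_*\in\mathbb R^d$ with $\|\theta_*\|_1=1$ such that the expected regret of $\mathcal G$ over $T$ rounds satisfies $$\mathbb E\Big[\sum_{t=1}^T\theta_*^\top(2a_*-a_{0,t}-a_{1,t})\Big]\ \ge\ \frac{e^{-2}}{4}(d-1)\sqrt T,\qquad a_*\in\arg\max_{a\in\mathcal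 A}\theta_*^\top a .$$ -/

import Mathlib

open MeasureTheory ProbabilityTheory Matrix

noncomputable section

namespace LearningUser

/-- Arms and preference parameters: vectors of `ℝ^d`. All norms used are written out explicitly. -/
abbrev Arm (d : ℕ) : Type := Fin d → ℝ

/-- The user's data before a round that is preceded by `t` rounds: consumed arms with rewards. -/
abbrev UserHistory (d t : ℕ) : Type := Fin t → Arm d × ℝ

/-- The arm with index `i` (`false` is `0`, `true` is `1`) of a recommended pair. -/
def pick {d : ℕ} (q : Arm d × Arm d) (i : Bool) : Arm d := bif i then q.2 else q.1

/-- The weighted norm `‖x‖_M = √(xᵀ M x)`. -/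
def weightedNorm {d : ℕ} (M : Matrix (Fin d) (Fin d) ℝ) (x : Arm d) : ℝ :=
  Real.sqrt (x ⬝ᵥ (M *ᵥ x))

/-- The hypercube `[-1, 1]^d`. -/
def hypercube (d : ℕ) : Set (Arm d) := {a | ∀ i, a i ∈ Set.Icc (-1 : ℝ) 1}

/-- The unit sphere of the `ℓ¹` norm of `ℝ^d`. -/
def l1Sphere (d : ℕ) : Set (Arm d) := {θ | ∑ i, |θ i| = 1}

/-- A (possibly randomized) system algorithm on the action set `A`. It draws a private seed and, in
each round, recommends a pair of arms of `A` as a function of the seed and of the user's past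
choices. (Its own past recommendations are functions of the same data, so that they need not be
listed separately.) It sees neither the rewards nor the user's estimates. -/
structure SystemAlgorithm {d : ℕ} (A : Set (Arm d)) where
  Seed : Type
  [measurableSpaceSeed : MeasurableSpace Seed]
  seedLaw : Measure Seed
  [isProbabilityMeasure_seedLaw : IsProbabilityMeasure seedLaw]
  recommend : (t : ℕ) → Seed → (Fin t → Bool) → Arm d × Arm d
  measurable_recommend : ∀ t choices, Measurable fun s => recommend t s choices
  recommend_mem : ∀ t s choices,
    (recommend t s choices).1 ∈ A ∧ (recommend t s choices).2 ∈ A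

attribute [instance] SystemAlgorithm.measurableSpaceSeed
  SystemAlgorithm.isProbabilityMeasure_seedLaw

/-- A user: a prior matrix `V₀`, an estimation rule, exploration bonuses `β` and a choice rule.
The preference parameter is not an input: the user knows it only through the data. -/
structure User (d : ℕ) where
  /-- The prior knowledge `V₀`. -/
  prior : Matrix (Fin d) (Fin d) ℝ
  posDef_prior : prior.PosDef
  /-- The estimate `θ_t = F(H_{t-1})`. -/
  estimate : (t : ℕ) → UserHistory d t → Arm d
  measurable_estimate : ∀ t, Measurable (estimate t)
  /-- The exploration coefficient of the arm with the given index of the recommended pair. -/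
  bonus : Bool → (t : ℕ) → UserHistory d t → Arm d × Arm d → ℝ
  /-- The index of the arm that is chosen from the recommended pair. -/
  choose : (t : ℕ) → UserHistory d t → Arm d × Arm d → Bool
  measurable_choose : ∀ t,
    Measurable fun p : UserHistory d t × (Arm d × Arm d) => choose t p.1 p.2

namespace User

variable {d : ℕ} (U : User d)

/-- The matrix `V = V₀ + ∑ a_s a_sᵀ`, the sum running over the arms consumed so far. -/
def designMatrix {t : ℕ} (h : UserHistory d t) : Matrix (Fin d) (Fin d) ℝ :=
  U.prior + ∑ s, vecMulVec (h s).1 (h s).1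

/-- The index `θ_tᵀ a_i + β^{(i)} ‖a_i‖_{V⁻¹}` of the arm `a_i` of the recommended pair. -/
def index {t : ℕ} (h : UserHistory d t) (q : Arm d × Arm d) (i : Bool) : ℝ :=
  U.estimate t h ⬝ᵥ pick q i +
    U.bonus i t h q * weightedNorm (U.designMatrix h)⁻¹ (pick q i)

/-- The decision rule: the bonuses in the `n`-th round lie in `[-c₂ n^γ₂, c₂ n^γ₂]`, and the user
returns an arm of largest index, ties being broken arbitrarily. -/
def DecisionRule (A : Set (Arm d)) (c₂ γ₂ : ℝ) : Prop :=
  ∀ (t : ℕ) (h : UserHistory d t) (q : Arm d × Arm d),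
    (∀ s, (h s).1 ∈ A) → q.1 ∈ A → q.2 ∈ A →
      (∀ i, |U.bonus i t h q| ≤ c₂ * ((t : ℝ) + 1) ^ γ₂) ∧
      ∀ i, U.index h q i ≤ U.index h q (U.choose t h q)

end User

section Interaction

variable {d : ℕ} {A : Set (Arm d)} (G : SystemAlgorithm A) (U : User d) (θ : Arm d)

/-- The first `t` rounds of the interaction, for a seed of the system and reward noises `η`: the
user's choices (which the system sees), and the consumed arms together with the rewards
`⟨θ, a⟩ + η` (which the user sees). -/
def play (s : G.Seed) (η : ℕ → ℝ) : (t : ℕ) → (Fin t → Bool) × UserHistory d t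
  | 0 => (Fin.elim0, Fin.elim0)
  | t + 1 =>
    let past := play s η t
    let q := G.recommend t s past.1
    let i := U.choose t past.2 q
    (Fin.snoc (α := fun _ => Bool) past.1 i,
      Fin.snoc (α := fun _ => Arm d × ℝ) past.2 (pick q i, θ ⬝ᵥ pick q i + η t))

/-- The pair of arms recommended in the round that is preceded by `t` rounds. -/
def recommended (t : ℕ) (ω : G.Seed × (ℕ → ℝ)) : Arm d × Arm d :=
  G.recommend t ω.1 (play G U θ ω.1 ω.2 t).1

/-- The user's data before the round that is preceded by `t` rounds. -/
def userHistory (t : ℕ) (ω : G.Seed × (ℕ → ℝ)) : UserHistory d t :=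
  (play G U θ ω.1 ω.2 t).2

/-- The law of the randomness: the seed, and independent reward noises of law `ν`. -/
def law (ν : Measure ℝ) [IsProbabilityMeasure ν] : Measure (G.Seed × (ℕ → ℝ)) :=
  G.seedLaw.prod (Measure.infinitePi fun _ : ℕ => ν)

/-- The regret `∑ θᵀ (2 a⋆ - a₀ - a₁)` of the system over `T` rounds. -/
def regret (aStar : Arm d) (T : ℕ) (ω : G.Seed × (ℕ → ℝ)) : ℝ :=
  ∑ t ∈ Finset.range T, θ ⬝ᵥ ((2 : ℝ) • aStar -
    (recommended G U θ t ω).1 - (recommended G U θ t ω).2)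

end Interaction

/-- The estimation rule: for every true parameter `θ` in `Θ` and every system algorithm,
in the `n`-th round `‖θ - θ_n‖_{V_n} ≤ c₁ n^γ₁ g(δ)` holds with probability at least `1 - δ`. -/
def User.EstimationRule {d : ℕ} (U : User d) (A Θ : Set (Arm d)) (ν : Measure ℝ)
    [IsProbabilityMeasure ν] (c₁ γ₁ : ℝ) (g : ℝ → ℝ) : Prop :=
  ∀ θ ∈ Θ, ∀ G : SystemAlgorithm A, ∀ t : ℕ, ∀ δ ∈ Set.Ioo (0 : ℝ) 1,
    ENNReal.ofReal (1 - δ) ≤ law G ν {ω |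
      weightedNorm (U.designMatrix (userHistory G U θ t ω))
        (θ - U.estimate t (userHistory G U θ t ω)) ≤ c₁ * ((t : ℝ) + 1) ^ γ₁ * g δ}

/-- `(c, γ)`-rationality of a user on the action set `A`, for parameters in `Θ` and reward noise
of law `ν`. -/
def User.IsRational {d : ℕ} (U : User d) (A Θ : Set (Arm d)) (ν : Measure ℝ)
    [IsProbabilityMeasure ν] (c γ : ℝ) : Prop :=
  ∃ (c₁ c₂ γ₁ γ₂ : ℝ) (g : ℝ → ℝ),
    0 ≤ c₁ ∧ 0 ≤ c₂ ∧ γ₁ ∈ Set.Ico (0 : ℝ) (1 / 2) ∧ γ₂ ∈ Set.Ico (0 : ℝ) (1 / 2) ∧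
    max c₁ c₂ ≤ c ∧ max γ₁ γ₂ ≤ γ ∧
    U.EstimationRule A Θ ν c₁ γ₁ g ∧ U.DecisionRule A c₂ γ₂

end LearningUser

end

/-! Lower bound. The recommendations are functions of the seed and of the user's choices, and the
parameter enters the interaction only through the noisy rewards. So the system cannot separate two
parameters whose reward laws are close. Take parameters `signedParam Δ i₀ σ` with unknown signs `σ`,
of modulus `Δ = 1 / (2√T)` off one coordinate `i₀` that carries the remaining mass. Flipping one
sign changes each mean reward by at most `2Δ`, and a change of measure (`lintegral_seedPast_add`)
bounds the second moment of the likelihood ratio after `t ≤ T` rounds by `exp (t (2Δ)²) ≤ e`. Hence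
(`two_point`) the regrets in coordinate `j` under a sign vector and under its flip at `j` add up to
at least `Δ` per round. Averaging over all `σ` yields one with regret at least `(d - 1) T Δ / 2 = (d
- 1) √T / 4`, which exceeds the required bound because `exp (-2) ≤ 1`.

Existence. The witness is the greedy ridge regression user. The squared error `‖θ - θ_t‖²` in the
norm of the Gram matrix, minus the log-determinant of that matrix, is a supermartingale
(`potential_step`). The determinant is polynomial in `t`, so the expected squared error is `O(log
t)`, below any power `t^(2ρ)`, and Markov's inequality gives the confidence bound. -/

noncomputable section

namespace LearningUser

open scoped ENNReal

/-! ### One-round dynamics, measurability, and independence of the current noise from the past -/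

section Step

variable {d : ℕ} {A : Set (Arm d)} (G : SystemAlgorithm A) (U : User d) (θ : Arm d)

/-- The past of the interaction: the choices seen by the system and the data of the user. -/
abbrev Past (d t : ℕ) : Type := (Fin t → Bool) × UserHistory d t

/-- The arm consumed after the given past. -/
def consumed {t : ℕ} (z : G.Seed × Past d t) : Arm d :=
  pick (G.recommend t z.1 z.2.1) (U.choose t z.2.2 (G.recommend t z.1 z.2.1))

/-- The past after one more round with reward noise `y`. -/
def extend {t : ℕ} (z : G.Seed × Past d t) (y : ℝ) : Past d (t + 1) :=
  (Fin.snoc (α := fun _ => Bool) z.2.1 (U.choose t z.2.2 (G.recommend t z.1 z.2.1)),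
    Fin.snoc (α := fun _ => Arm d × ℝ) z.2.2 (consumed G U z, θ ⬝ᵥ consumed G U z + y))

/-- The seed together with the past before the round preceded by `t` rounds. -/
def seedPast (t : ℕ) (ω : G.Seed × (ℕ → ℝ)) : G.Seed × Past d t :=
  (ω.1, play G U θ ω.1 ω.2 t)

lemma play_succ (s : G.Seed) (η : ℕ → ℝ) (t : ℕ) :
    play G U θ s η (t + 1) = extend G U θ (s, play G U θ s η t) (η t) := rfl

lemma measurable_dotProduct_left {d : ℕ} (v : Arm d) : Measurable fun a : Arm d => v ⬝ᵥ a := by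
  unfold dotProduct
  fun_prop

/-- Choice sequences form a countable space, so measurability in the seed alone suffices for joint
measurability. -/
lemma measurable_recommend_uncurry (t : ℕ) :
    Measurable fun z : G.Seed × (Fin t → Bool) => G.recommend t z.1 z.2 :=
  measurable_from_prod_countable_left fun c => G.measurable_recommend t c

lemma measurable_recommend_past (t : ℕ) :
    Measurable fun z : G.Seed × Past d t => G.recommend t z.1 z.2.1 :=
  (measurable_recommend_uncurry G t).comp (f := fun z : G.Seed × Past d t => (z.1, z.2.1))
    (by fun_prop)

lemma measurable_choose_past (t : ℕ) :
    Measurable fun z : G.Seed × Past d t => U.choose t z.2.2 (G.recommend t z.1 z.2.1) :=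
  (U.measurable_choose t).comp (Measurable.prodMk (by fun_prop) (measurable_recommend_past G t))

lemma measurable_pick : Measurable fun p : (Arm d × Arm d) × Bool => pick p.1 p.2 := by
  refine measurable_from_prod_countable_left fun b => ?_
  cases b
  · exact measurable_fst
  · exact measurable_snd

lemma measurable_consumed (t : ℕ) :
    Measurable fun z : G.Seed × Past d t => consumed G U z :=
  measurable_pick.comp ((measurable_recommend_past G t).prodMk (measurable_choose_past G U t))

lemma measurable_snoc {α X : Type*} [MeasurableSpace α] [MeasurableSpace X] {t : ℕ}
    {f : X → Fin t → α} {g : X → α} (hf : Measurable f) (hg : Measurable g) :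
    Measurable fun x => Fin.snoc (α := fun _ => α) (f x) (g x) := by
  refine measurable_pi_lambda _ fun i => ?_
  refine Fin.lastCases ?_ (fun j => ?_) i
  · simpa using hg
  · simpa [Function.comp_def] using (measurable_pi_apply j).comp hf

lemma measurable_extend (t : ℕ) :
    Measurable fun p : (G.Seed × Past d t) × ℝ => extend G U θ p.1 p.2 := by
  have hc : Measurable fun p : (G.Seed × Past d t) × ℝ => consumed G U p.1 :=
    (measurable_consumed G U t).comp measurable_fst
  exact (measurable_snoc (by fun_prop) ((measurable_choose_past G U t).comp measurable_fst)).prodMk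
    (measurable_snoc (by fun_prop)
      (hc.prodMk (((measurable_dotProduct_left θ).comp hc).add measurable_snd)))

lemma measurable_seedPast (t : ℕ) : Measurable (seedPast G U θ t) := by
  induction t with
  | zero =>
    exact measurable_fst.prodMk measurable_const
  | succ t ih =>
    exact measurable_fst.prodMk ((measurable_extend G U θ t).comp
      (ih.prodMk ((measurable_pi_apply t).comp measurable_snd)))

lemma play_congr (s : G.Seed) {η η' : ℕ → ℝ} (t : ℕ) (h : ∀ i < t, η i = η' i) :
    play G U θ s η t = play G U θ s η' t := by
  induction t with
  | zero => rfl
  | succ t ih =>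
    rw [play_succ, play_succ, ih fun i hi => h i (by omega), h t (by omega)]

instance (ν : Measure ℝ) [IsProbabilityMeasure ν] : IsProbabilityMeasure (law G ν) := by
  unfold law
  infer_instance

variable (ν : Measure ℝ) [IsProbabilityMeasure ν]

/-- For a fixed seed, the first `t` rounds depend only on the noises with index below `t`, which are
independent of the noise with index `t`. -/
lemma map_play_noise (s : G.Seed) (t : ℕ) :
    (Measure.infinitePi fun _ : ℕ => ν).map (fun η => (play G U θ s η t, η t)) =
      ((Measure.infinitePi fun _ : ℕ => ν).map fun η => play G U θ s η t).prod ν := by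
  have hm : Measurable fun η : ℕ → ℝ => play G U θ s η t :=
    measurable_snd.comp ((measurable_seedPast G U θ t).comp measurable_prodMk_left)
  have hind : iIndepFun (fun (i : ℕ) (η : ℕ → ℝ) => η i) (Measure.infinitePi fun _ : ℕ => ν) :=
    iIndepFun_infinitePi (X := fun _ x => x) (fun _ => measurable_id)
  have h := hind.indepFun_finset (Finset.range t) {t} (by simp) (fun i => measurable_pi_apply i)
  -- Padding by zeros turns the first `t` noises into a full sequence that `play` accepts; by
  -- `play_congr` the padding does not affect the past.
  let e : ((i : Finset.range t) → ℝ) → ℕ → ℝ := fun x i =>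
    if hi : i ∈ Finset.range t then x ⟨i, hi⟩ else 0
  have he : Measurable e := by
    refine measurable_pi_lambda _ fun i => ?_
    by_cases hi : i ∈ Finset.range t
    · simp only [e, hi, dif_pos]; exact measurable_pi_apply _
    · simp only [e, hi, dif_neg, not_false_iff]; exact measurable_const
  have h2 : IndepFun (fun η : ℕ → ℝ => play G U θ s η t) (fun η : ℕ → ℝ => η t)
      (Measure.infinitePi fun _ : ℕ => ν) := by
    have := h.comp (hm.comp he)
      (measurable_pi_apply (⟨t, Finset.mem_singleton_self t⟩ : ({t} : Finset ℕ)))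
    convert this using 2 with η
    · refine play_congr G U θ s t fun i hi => ?_
      simp [e, hi]
    · rfl
  rw [(indepFun_iff_map_prod_eq_prod_map_map hm.aemeasurable
    (measurable_pi_apply t).aemeasurable).1 h2,
    Measure.infinitePi_map_eval]

/-- The noise of a round is independent of the seed and of the past. -/
lemma lintegral_seedPast_noise (t : ℕ) {f : (G.Seed × Past d t) × ℝ → ℝ≥0∞} (hf : Measurable f) :
    ∫⁻ ω, f (seedPast G U θ t ω, ω.2 t) ∂law G ν =
      ∫⁻ ω, ∫⁻ y, f (seedPast G U θ t ω, y) ∂ν ∂law G ν := by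
  have hs := measurable_seedPast G U θ t
  have hF : Measurable fun z => ∫⁻ y, f (z, y) ∂ν := hf.lintegral_prod_right'
  unfold law
  rw [lintegral_prod _ (Measurable.aemeasurable (by fun_prop)),
    lintegral_prod _ (Measurable.aemeasurable (by fun_prop))]
  refine lintegral_congr fun s => ?_
  have hm : Measurable fun η : ℕ → ℝ => play G U θ s η t :=
    measurable_snd.comp (hs.comp measurable_prodMk_left)
  have hfs : Measurable fun p : Past d t × ℝ => f ((s, p.1), p.2) := by fun_prop
  have h1 := lintegral_map (μ := Measure.infinitePi fun _ : ℕ => ν) hfs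
    (hm.prodMk (measurable_pi_apply t))
  rw [map_play_noise, lintegral_prod _ hfs.aemeasurable,
    lintegral_map hfs.lintegral_prod_right' hm] at h1
  exact h1.symm

lemma lintegral_seedPast_succ (t : ℕ) {f : G.Seed × Past d (t + 1) → ℝ≥0∞} (hf : Measurable f) :
    ∫⁻ ω, f (seedPast G U θ (t + 1) ω) ∂law G ν =
      ∫⁻ ω, ∫⁻ y, f (ω.1, extend G U θ (seedPast G U θ t ω) y) ∂ν ∂law G ν := by
  have := measurable_extend G U θ t
  exact lintegral_seedPast_noise G U θ ν t
    (f := fun p => f (p.1.1, extend G U θ p.1 p.2)) (by fun_prop)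

end Step

/-! ### Gaussian shifts and moments of their densities -/

section Gaussian

/-- The exponential weight is the density of `N(x, 1)` with respect to `N(0, 1)`. -/
lemma lintegral_gaussianReal_add {f : ℝ → ℝ≥0∞} (hf : Measurable f) (x : ℝ) :
    ∫⁻ y, f (y + x) ∂gaussianReal 0 1 =
      ∫⁻ y, ENNReal.ofReal (Real.exp (x * y - x ^ 2 / 2)) * f y ∂gaussianReal 0 1 := by
  rw [← lintegral_map hf (measurable_add_const x), gaussianReal_map_add_const,
    gaussianReal_of_var_ne_zero _ one_ne_zero, gaussianReal_of_var_ne_zero _ one_ne_zero,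
    lintegral_withDensity_eq_lintegral_mul _ (measurable_gaussianPDF _ _) hf,
    lintegral_withDensity_eq_lintegral_mul _ (measurable_gaussianPDF _ _) (by fun_prop)]
  refine lintegral_congr fun y => ?_
  simp only [Pi.mul_apply, gaussianPDF, ← mul_assoc]
  rw [← ENNReal.ofReal_mul (gaussianPDFReal_nonneg _ _ _), gaussianPDFReal, gaussianPDFReal,
    mul_assoc _ (Real.exp _) (Real.exp _), ← Real.exp_add]
  congr 4
  push_cast
  ring

lemma lintegral_exp_gaussianReal (x : ℝ) :
    ∫⁻ y, ENNReal.ofReal (Real.exp (x * y - x ^ 2 / 2)) ∂gaussianReal 0 1 = 1 := by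
  simpa using (lintegral_gaussianReal_add (f := fun _ => 1) measurable_const x).symm

lemma lintegral_exp_sq_gaussianReal (x : ℝ) :
    ∫⁻ y, ENNReal.ofReal (Real.exp (x * y - x ^ 2 / 2) ^ 2) ∂gaussianReal 0 1 =
      ENNReal.ofReal (Real.exp (x ^ 2)) := by
  have h : ∀ y, ENNReal.ofReal (Real.exp (x * y - x ^ 2 / 2) ^ 2) =
      ENNReal.ofReal (Real.exp (x ^ 2)) *
        ENNReal.ofReal (Real.exp (2 * x * y - (2 * x) ^ 2 / 2)) := by
    intro y
    rw [← ENNReal.ofReal_mul (Real.exp_pos _).le, ← Real.exp_add, ← Real.exp_nat_mul]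
    congr 2
    push_cast
    ring
  simp_rw [h]
  rw [lintegral_const_mul _ (by fun_prop), lintegral_exp_gaussianReal, mul_one]

end Gaussian

/-! ### Change of measure and the two-point inequality -/

section Likelihood

variable {d : ℕ}

/-- The likelihood ratio of the parameters `θ + v` and `θ` at the data of the user. -/
def likelihoodRatio (θ v : Arm d) {t : ℕ} (h : UserHistory d t) : ℝ :=
  ∏ s, Real.exp ((v ⬝ᵥ (h s).1) * ((h s).2 - θ ⬝ᵥ (h s).1) - (v ⬝ᵥ (h s).1) ^ 2 / 2)

lemma likelihoodRatio_nonneg (θ v : Arm d) {t : ℕ} (h : UserHistory d t) :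
    0 ≤ likelihoodRatio θ v h := by
  unfold likelihoodRatio
  positivity

lemma measurable_likelihoodRatio (θ v : Arm d) (t : ℕ) :
    Measurable fun h : UserHistory d t => likelihoodRatio θ v h := by
  have := measurable_dotProduct_left θ
  have := measurable_dotProduct_left v
  unfold likelihoodRatio
  fun_prop

variable {A : Set (Arm d)} (G : SystemAlgorithm A) (U : User d) (θ v : Arm d)

lemma measurable_likelihoodRatio_seedPast (t : ℕ) :
    Measurable fun ω => likelihoodRatio θ v (seedPast G U θ t ω).2.2 :=
  (measurable_likelihoodRatio θ v t).comp
    (measurable_snd.comp (measurable_snd.comp (measurable_seedPast G U θ t)))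

lemma likelihoodRatio_extend {t : ℕ} (z : G.Seed × Past d t) (y : ℝ) :
    likelihoodRatio θ v (extend G U θ z y).2 = likelihoodRatio θ v z.2.2 *
      Real.exp ((v ⬝ᵥ consumed G U z) * y - (v ⬝ᵥ consumed G U z) ^ 2 / 2) := by
  simp [likelihoodRatio, extend, Fin.prod_univ_castSucc]

/-- Given the past, the parameter acts only on the reward, so shifting it amounts to shifting the
noise. -/
lemma extend_add {t : ℕ} (z : G.Seed × Past d t) (y : ℝ) :
    extend G U (θ + v) z y = extend G U θ z (y + v ⬝ᵥ consumed G U z) := by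
  unfold extend
  rw [add_dotProduct, add_assoc, add_comm (v ⬝ᵥ _) y]

/-- Change of measure from the parameter `θ + v` to `θ`. -/
lemma lintegral_seedPast_add (t : ℕ) {f : G.Seed × Past d t → ℝ≥0∞} (hf : Measurable f) :
    ∫⁻ ω, f (seedPast G U (θ + v) t ω) ∂law G (gaussianReal 0 1) =
      ∫⁻ ω, ENNReal.ofReal (likelihoodRatio θ v (seedPast G U θ t ω).2.2) *
        f (seedPast G U θ t ω) ∂law G (gaussianReal 0 1) := by
  induction t with
  | zero => simp [likelihoodRatio, seedPast, play]
  | succ t ih =>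
    have hL := measurable_likelihoodRatio θ v (t + 1)
    have he := measurable_extend G U (θ + v) t
    have he' := measurable_extend G U θ t
    rw [lintegral_seedPast_succ G U (θ + v) _ t hf, lintegral_seedPast_succ G U θ _ t
      (f := fun z => ENNReal.ofReal (likelihoodRatio θ v z.2.2) * f z) (by fun_prop)]
    have hF : Measurable fun z : G.Seed × Past d t =>
        ∫⁻ y, f (z.1, extend G U (θ + v) z y) ∂gaussianReal 0 1 :=
      Measurable.lintegral_prod_right' (f := fun p => f (p.1.1, extend G U (θ + v) p.1 p.2))
        (by fun_prop)
    -- With the last noise integrated out, the induction hypothesis changes the parameter on the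
    -- past; the Gaussian shift then supplies the last factor of the likelihood ratio.
    refine (ih hF).trans (lintegral_congr fun ω => ?_)
    set z := seedPast G U θ t ω with hz
    have hez : Measurable (extend G U θ z) := he'.comp measurable_prodMk_left
    simp_rw [extend_add, likelihoodRatio_extend]
    rw [lintegral_gaussianReal_add (f := fun y => f (z.1, extend G U θ z y)) (by fun_prop),
      ← lintegral_const_mul _ (by fun_prop)]
    refine lintegral_congr fun y => ?_
    rw [ENNReal.ofReal_mul (likelihoodRatio_nonneg _ _ _), mul_assoc]
    rfl

lemma lintegral_likelihoodRatio (t : ℕ) :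
    ∫⁻ ω, ENNReal.ofReal (likelihoodRatio θ v (seedPast G U θ t ω).2.2)
      ∂law G (gaussianReal 0 1) = 1 := by
  simpa using (lintegral_seedPast_add G U θ v t (f := fun _ => 1) measurable_const).symm

lemma pick_mem {q : Arm d × Arm d} (h : q.1 ∈ A ∧ q.2 ∈ A) (i : Bool) : pick q i ∈ A := by
  cases i
  · exact h.1
  · exact h.2

lemma consumed_mem {t : ℕ} (z : G.Seed × Past d t) : consumed G U z ∈ A :=
  pick_mem (G.recommend_mem _ _ _) _

/-- Given the past, a round in which `a` is consumed multiplies the second moment by `exp ((v ⬝ᵥ a)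
^ 2)`, at most `exp B`. -/
lemma lintegral_likelihoodRatio_sq_le {B : ℝ} (hB : ∀ a ∈ A, (v ⬝ᵥ a) ^ 2 ≤ B) (t : ℕ) :
    ∫⁻ ω, ENNReal.ofReal (likelihoodRatio θ v (seedPast G U θ t ω).2.2 ^ 2)
      ∂law G (gaussianReal 0 1) ≤ ENNReal.ofReal (Real.exp (t * B)) := by
  induction t with
  | zero => simp [likelihoodRatio]
  | succ t ih =>
    have hL := measurable_likelihoodRatio θ v
    have hLs := measurable_likelihoodRatio_seedPast G U θ v t
    rw [lintegral_seedPast_succ G U θ _ t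
      (f := fun z => ENNReal.ofReal (likelihoodRatio θ v z.2.2 ^ 2)) (by fun_prop)]
    calc _ ≤ ∫⁻ ω, ENNReal.ofReal (likelihoodRatio θ v (seedPast G U θ t ω).2.2 ^ 2) *
          ENNReal.ofReal (Real.exp B) ∂law G (gaussianReal 0 1) := by
          refine lintegral_mono fun ω => ?_
          simp_rw [likelihoodRatio_extend, mul_pow, ENNReal.ofReal_mul (sq_nonneg _)]
          rw [lintegral_const_mul _ (by fun_prop), lintegral_exp_sq_gaussianReal]
          gcongr
          exact hB _ (consumed_mem G U _)
      _ ≤ ENNReal.ofReal (Real.exp (t * B)) * ENNReal.ofReal (Real.exp B) := by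
          rw [lintegral_mul_const _ (by fun_prop)]
          gcongr
      _ = _ := by
          rw [← ENNReal.ofReal_mul (Real.exp_pos _).le, ← Real.exp_add]
          congr 2
          push_cast
          ring

/-- Two-point inequality: no statistic of the past tells `θ + v` from `θ`. -/
lemma two_point {B : ℝ} (hB : ∀ a ∈ A, (v ⬝ᵥ a) ^ 2 ≤ B) (t : ℕ)
    {f : G.Seed × Past d t → ℝ} (hf : Measurable f) (hf1 : ∀ z, |f z| ≤ 1) :
    2 - Real.exp (t * B) / 2 ≤
      ∫ ω, (1 - f (seedPast G U (θ + v) t ω)) ∂law G (gaussianReal 0 1) +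
      ∫ ω, (1 + f (seedPast G U θ t ω)) ∂law G (gaussianReal 0 1) := by
  set P := law G (gaussianReal 0 1) with hP
  have hL := measurable_likelihoodRatio_seedPast G U θ v t
  have hs := measurable_seedPast G U θ t
  have hs' := measurable_seedPast G U (θ + v) t
  have hn : ∀ z, 0 ≤ 1 - f z := fun z => by linarith [(abs_le.1 (hf1 z)).2]
  have hp : ∀ z, 0 ≤ 1 + f z := fun z => by linarith [(abs_le.1 (hf1 z)).1]
  have hbound : ∀ {X : G.Seed × (ℕ → ℝ) → ℝ}, Measurable X → (∀ ω, |X ω| ≤ 2) →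
      Integrable X P := fun hX hb =>
    Integrable.of_bound hX.aestronglyMeasurable 2 (Filter.Eventually.of_forall hb)
  have hI1 : Integrable (fun ω => 1 - f (seedPast G U (θ + v) t ω)) P :=
    hbound (by fun_prop) fun ω => by
      have := abs_le.1 (hf1 (seedPast G U (θ + v) t ω))
      exact abs_le.2 ⟨by linarith, by linarith⟩
  have hI2 : Integrable (fun ω => 1 + f (seedPast G U θ t ω)) P :=
    hbound (by fun_prop) fun ω => by
      have := abs_le.1 (hf1 (seedPast G U θ t ω))
      exact abs_le.2 ⟨by linarith, by linarith⟩
  have key : (2 : ℝ≥0∞) ≤ ∫⁻ ω, ENNReal.ofReal (1 - f (seedPast G U (θ + v) t ω)) ∂P +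
      ∫⁻ ω, ENNReal.ofReal (1 + f (seedPast G U θ t ω)) ∂P +
      ENNReal.ofReal (1 / 2) * ENNReal.ofReal (Real.exp (t * B)) := by
    rw [lintegral_seedPast_add G U θ v t (f := fun z => ENNReal.ofReal (1 - f z)) (by fun_prop)]
    calc (2 : ℝ≥0∞) = ∫⁻ ω, 2 * ENNReal.ofReal
          (likelihoodRatio θ v (seedPast G U θ t ω).2.2) ∂P := by
          rw [lintegral_const_mul _ (by fun_prop), lintegral_likelihoodRatio, mul_one]
      _ ≤ ∫⁻ ω, (ENNReal.ofReal (likelihoodRatio θ v (seedPast G U θ t ω).2.2) *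
            ENNReal.ofReal (1 - f (seedPast G U θ t ω)) +
            ENNReal.ofReal (1 + f (seedPast G U θ t ω)) +
            ENNReal.ofReal (1 / 2) *
              ENNReal.ofReal (likelihoodRatio θ v (seedPast G U θ t ω).2.2 ^ 2)) ∂P := by
          refine lintegral_mono fun ω => ?_
          have hl := likelihoodRatio_nonneg θ v (seedPast G U θ t ω).2.2
          generalize likelihoodRatio θ v (seedPast G U θ t ω).2.2 = l at hl
          have h1 := hn (seedPast G U θ t ω)
          have h2 := hp (seedPast G U θ t ω)
          generalize f (seedPast G U θ t ω) = x at h1 h2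
          rw [← ENNReal.ofReal_mul hl, ← ENNReal.ofReal_mul (by norm_num),
            ← ENNReal.ofReal_add (by positivity) h2, ← ENNReal.ofReal_add (by positivity)
            (by positivity), ← ENNReal.ofReal_ofNat 2, ← ENNReal.ofReal_mul (by norm_num)]
          refine ENNReal.ofReal_le_ofReal ?_
          -- `l (1 - x) + (1 + x) + l² / 2 - 2 l = (l - 1 - x)² / 2 + (1 - x)(1 + x) / 2`. Since `l`
          -- has mean one, the term `2 l` integrates to the constant `2`.
          nlinarith [sq_nonneg (l - 1 - x), mul_nonneg h1 h2]
      _ = _ + _ + ENNReal.ofReal (1 / 2) * ∫⁻ ω, ENNReal.ofReal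
            (likelihoodRatio θ v (seedPast G U θ t ω).2.2 ^ 2) ∂P := by
          rw [lintegral_add_right _ (by fun_prop), lintegral_add_right _ (by fun_prop),
            lintegral_const_mul _ (by fun_prop)]
      _ ≤ _ := by
          gcongr
          exact lintegral_likelihoodRatio_sq_le G U θ v hB t
  rw [← ofReal_integral_eq_lintegral_ofReal hI1 (Filter.Eventually.of_forall fun ω => hn _),
    ← ofReal_integral_eq_lintegral_ofReal hI2 (Filter.Eventually.of_forall fun ω => hp _),
    ← ENNReal.ofReal_mul (by norm_num), ← ENNReal.ofReal_add
      (integral_nonneg fun ω => hn _) (integral_nonneg fun ω => hp _),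
    ← ENNReal.ofReal_add (add_nonneg (integral_nonneg fun ω => hn _)
      (integral_nonneg fun ω => hp _)) (by positivity), ← ENNReal.ofReal_ofNat 2,
    ENNReal.ofReal_le_ofReal_iff (add_nonneg (add_nonneg (integral_nonneg fun ω => hn _)
      (integral_nonneg fun ω => hp _)) (by positivity))] at key
  linarith

end Likelihood

/-! ### Regret lower bound by averaging over sign vectors -/

section LowerBound

variable {d : ℕ} (G : SystemAlgorithm (hypercube d)) (U : User d)

/-- The mean of the `i`-th coordinates of the recommended arms. -/
def meanCoord (i : Fin d) (t : ℕ) (z : G.Seed × Past d t) : ℝ :=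
  ((G.recommend t z.1 z.2.1).1 i + (G.recommend t z.1 z.2.1).2 i) / 2

lemma measurable_meanCoord (i : Fin d) (t : ℕ) : Measurable (meanCoord G i t) := by
  have := measurable_recommend_past G t
  unfold meanCoord
  fun_prop

lemma abs_meanCoord_le (i : Fin d) (t : ℕ) (z : G.Seed × Past d t) : |meanCoord G i t z| ≤ 1 := by
  have h := G.recommend_mem t z.1 z.2.1
  have h1 := h.1 i
  have h2 := h.2 i
  simp only [Set.mem_Icc] at h1 h2
  unfold meanCoord
  exact abs_le.2 ⟨by linarith, by linarith⟩

/-- The vertex of the hypercube with the given signs. -/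
def vertex (σ : Fin d → Bool) : Arm d := fun j => if σ j then 1 else -1

/-- A parameter of `ℓ¹` norm one: the coordinates other than `i₀` have modulus `Δ`. -/
def signedParam (Δ : ℝ) (i₀ : Fin d) (σ : Fin d → Bool) : Arm d := fun j =>
  (if j = i₀ then 1 - (d - 1) * Δ else Δ) * vertex σ j

lemma abs_vertex (σ : Fin d → Bool) (j : Fin d) : |vertex σ j| = 1 := by
  unfold vertex
  split_ifs <;> simp

lemma vertex_mul_self (σ : Fin d → Bool) (j : Fin d) : vertex σ j * vertex σ j = 1 := by
  unfold vertex
  split_ifs <;> simp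

lemma vertex_mem (σ : Fin d → Bool) : vertex σ ∈ hypercube d := fun j =>
  abs_le.1 (abs_vertex σ j).le

lemma weight_nonneg {Δ : ℝ} (hΔ : 0 ≤ Δ) (h1 : (d - 1) * Δ ≤ 1) (i₀ j : Fin d) :
    0 ≤ if j = i₀ then 1 - (d - 1) * Δ else Δ := by
  split_ifs <;> linarith

lemma signedParam_mem {Δ : ℝ} (hΔ : 0 ≤ Δ) (h1 : (d - 1) * Δ ≤ 1) (i₀ : Fin d)
    (σ : Fin d → Bool) : signedParam Δ i₀ σ ∈ l1Sphere d := by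
  have hd : 1 ≤ d := i₀.pos
  simp only [l1Sphere, Set.mem_ofPred_eq, signedParam, abs_mul, abs_vertex, mul_one,
    abs_of_nonneg (weight_nonneg hΔ h1 i₀ _)]
  rw [← Finset.add_sum_erase _ _ (Finset.mem_univ i₀), if_pos rfl,
    Finset.sum_congr rfl fun j hj => if_neg (Finset.ne_of_mem_erase hj)]
  simp [Nat.cast_sub hd]

lemma signedParam_mul_le {Δ : ℝ} (hΔ : 0 ≤ Δ) (h1 : (d - 1) * Δ ≤ 1) (i₀ : Fin d)
    (σ : Fin d → Bool) {x : ℝ} (hx : |x| ≤ 1) (j : Fin d) :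
    signedParam Δ i₀ σ j * x ≤ signedParam Δ i₀ σ j * vertex σ j := by
  have hw := weight_nonneg hΔ h1 i₀ j
  simp only [signedParam, mul_assoc, vertex_mul_self]
  refine mul_le_mul_of_nonneg_left ?_ hw
  calc _ ≤ |vertex σ j * x| := le_abs_self _
    _ ≤ 1 := by rw [abs_mul, abs_vertex, one_mul]; exact hx

lemma signedParam_isMaxOn {Δ : ℝ} (hΔ : 0 ≤ Δ) (h1 : (d - 1) * Δ ≤ 1) (i₀ : Fin d)
    (σ : Fin d → Bool) {a : Arm d} (ha : a ∈ hypercube d) :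
    signedParam Δ i₀ σ ⬝ᵥ a ≤ signedParam Δ i₀ σ ⬝ᵥ vertex σ :=
  Finset.sum_le_sum fun j _ => signedParam_mul_le hΔ h1 i₀ σ (abs_le.2 (ha j)) j

/-- The instantaneous regret in a coordinate. -/
def coordRegret (θ a : Arm d) (j : Fin d) (t : ℕ) (ω : G.Seed × (ℕ → ℝ)) : ℝ :=
  2 * (θ j * (a j - meanCoord G j t (seedPast G U θ t ω)))

lemma regret_eq (θ a : Arm d) (T : ℕ) (ω : G.Seed × (ℕ → ℝ)) :
    regret G U θ a T ω = ∑ t ∈ Finset.range T, ∑ j, coordRegret G U θ a j t ω := by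
  refine Finset.sum_congr rfl fun t _ => Finset.sum_congr rfl fun j _ => ?_
  simp only [coordRegret, meanCoord, recommended, seedPast, Pi.sub_apply, Pi.smul_apply,
    smul_eq_mul]
  ring

lemma integrable_coordRegret (θ a : Arm d) (j : Fin d) (t : ℕ) :
    Integrable (coordRegret G U θ a j t) (law G (gaussianReal 0 1)) := by
  have := measurable_meanCoord G j t
  have := measurable_seedPast G U θ t
  have hi : Integrable (fun ω => meanCoord G j t (seedPast G U θ t ω))
      (law G (gaussianReal 0 1)) :=
    Integrable.of_bound (C := 1) (Measurable.aestronglyMeasurable (by fun_prop))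
      (Filter.Eventually.of_forall fun ω => abs_meanCoord_le G j t _)
  exact (((integrable_const _).sub hi).const_mul _).const_mul _

lemma integrable_regret (θ a : Arm d) (T : ℕ) :
    Integrable (regret G U θ a T) (law G (gaussianReal 0 1)) := by
  have h : regret G U θ a T = fun ω =>
      ∑ t ∈ Finset.range T, ∑ j, coordRegret G U θ a j t ω := funext (regret_eq G U θ a T)
  rw [h]
  exact integrable_finsetSum _ fun t _ => integrable_finsetSum _ fun j _ =>
    integrable_coordRegret G U θ a j t

/-- The expected regret in a coordinate over `T` rounds. -/
def expectedCoordRegret (T : ℕ) (θ a : Arm d) (j : Fin d) : ℝ :=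
  ∑ t ∈ Finset.range T, ∫ ω, coordRegret G U θ a j t ω ∂law G (gaussianReal 0 1)

lemma integral_regret (θ a : Arm d) (T : ℕ) :
    ∫ ω, regret G U θ a T ω ∂law G (gaussianReal 0 1) =
      ∑ j, expectedCoordRegret G U T θ a j := by
  simp_rw [regret_eq, expectedCoordRegret]
  rw [integral_finsetSum _ fun t _ => integrable_finsetSum _ fun j _ =>
    integrable_coordRegret G U θ a j t, Finset.sum_comm]
  exact Finset.sum_congr rfl fun t _ =>
    integral_finsetSum _ fun j _ => integrable_coordRegret G U θ a j t

/-- The sign vector with the sign of one coordinate reversed. -/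
def flipSign (j : Fin d) (σ : Fin d → Bool) : Fin d → Bool := Function.update σ j (!σ j)

lemma flipSign_involutive (j : Fin d) : Function.Involutive (flipSign j) := fun σ => by
  simp [flipSign]

lemma signedParam_flipSign (Δ : ℝ) {i₀ j : Fin d} (hj : j ≠ i₀) {σ : Fin d → Bool}
    (hσ : σ j = false) :
    signedParam Δ i₀ (flipSign j σ) = signedParam Δ i₀ σ + Pi.single j (2 * Δ) := by
  funext k
  by_cases hk : k = j
  · subst hk
    simp only [signedParam, flipSign, vertex, if_neg hj, hσ, Function.update_self, Pi.add_apply,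
      Pi.single_eq_same]
    simp
    ring
  · simp [signedParam, flipSign, vertex, hk]

lemma expectedCoordRegret_add_flipSign_of_false {Δ : ℝ} (hΔ : 0 ≤ Δ) {T : ℕ}
    (hT : T * (2 * Δ) ^ 2 ≤ 1) {i₀ j : Fin d} (hj : j ≠ i₀) {σ : Fin d → Bool}
    (hσ : σ j = false) :
    T * Δ ≤ expectedCoordRegret G U T (signedParam Δ i₀ σ) (vertex σ) j +
      expectedCoordRegret G U T (signedParam Δ i₀ (flipSign j σ)) (vertex (flipSign j σ)) j := by
  have hB : ∀ a ∈ hypercube d, ((Pi.single j (2 * Δ) : Arm d) ⬝ᵥ a) ^ 2 ≤ (2 * Δ) ^ 2 := by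
    intro a ha
    rw [single_dotProduct, mul_pow]
    exact mul_le_of_le_one_right (sq_nonneg _) ((sq_le_one_iff_abs_le_one _).2 (abs_le.2 (ha j)))
  unfold expectedCoordRegret
  rw [← Finset.sum_add_distrib]
  have hsum : (T : ℝ) * Δ = ∑ t ∈ Finset.range T, Δ := by simp
  rw [hsum]
  refine Finset.sum_le_sum fun t ht => ?_
  have h2 := two_point G U (signedParam Δ i₀ σ) (Pi.single j (2 * Δ)) hB t
    (measurable_meanCoord G j t) (abs_meanCoord_le G j t)
  rw [← signedParam_flipSign Δ hj hσ] at h2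
  have e1 : ∀ ω, coordRegret G U (signedParam Δ i₀ σ) (vertex σ) j t ω =
      2 * Δ * (1 + meanCoord G j t (seedPast G U (signedParam Δ i₀ σ) t ω)) := by
    intro ω
    simp [coordRegret, signedParam, vertex, hσ, hj]
    ring
  have e2 : ∀ ω, coordRegret G U (signedParam Δ i₀ (flipSign j σ)) (vertex (flipSign j σ)) j t ω =
      2 * Δ * (1 - meanCoord G j t (seedPast G U (signedParam Δ i₀ (flipSign j σ)) t ω)) := by
    intro ω
    have e : signedParam Δ i₀ (flipSign j σ) j = Δ ∧ vertex (flipSign j σ) j = 1 := by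
      simp [signedParam, vertex, hσ, hj, flipSign]
    rw [coordRegret, e.1, e.2, mul_assoc]
  simp_rw [e1, e2]
  rw [integral_const_mul, integral_const_mul, ← mul_add, add_comm (∫ _, _ ∂_)]
  -- From `e ≤ 3` the two-point bound is at least `2 - 3 / 2 = 1 / 2`, and the factor `2 * Δ` turns
  -- this into `Δ` per round.
  have hexp : Real.exp (t * (2 * Δ) ^ 2) ≤ 3 := by
    have ht' : (t : ℝ) ≤ T := by exact_mod_cast (Finset.mem_range.1 ht).le
    have : (t : ℝ) * (2 * Δ) ^ 2 ≤ 1 :=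
      (mul_le_mul_of_nonneg_right ht' (sq_nonneg _)).trans hT
    linarith [Real.exp_le_exp.2 this, Real.exp_one_lt_d9]
  calc Δ = 2 * Δ * (1 / 2) := by ring
    _ ≤ _ := mul_le_mul_of_nonneg_left (by linarith) (by positivity)

lemma expectedCoordRegret_add_flipSign {Δ : ℝ} (hΔ : 0 ≤ Δ) {T : ℕ}
    (hT : T * (2 * Δ) ^ 2 ≤ 1) {i₀ j : Fin d} (hj : j ≠ i₀) (σ : Fin d → Bool) :
    T * Δ ≤ expectedCoordRegret G U T (signedParam Δ i₀ σ) (vertex σ) j +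
      expectedCoordRegret G U T (signedParam Δ i₀ (flipSign j σ)) (vertex (flipSign j σ)) j := by
  cases hσ : σ j with
  | false => exact expectedCoordRegret_add_flipSign_of_false G U hΔ hT hj hσ
  | true =>
    have h := expectedCoordRegret_add_flipSign_of_false G U hΔ hT hj (σ := flipSign j σ)
      (by simp [flipSign, hσ])
    rwa [flipSign_involutive j σ, add_comm] at h

/-- Flipping the sign at `j` permutes the sign vectors, so summing the pairwise bound counts every
term twice. -/
lemma sum_expectedCoordRegret {Δ : ℝ} (hΔ : 0 ≤ Δ) {T : ℕ}
    (hT : T * (2 * Δ) ^ 2 ≤ 1) {i₀ j : Fin d} (hj : j ≠ i₀) :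
    ∑ _σ : Fin d → Bool, T * Δ / 2 ≤ ∑ σ : Fin d → Bool,
      expectedCoordRegret G U T (signedParam Δ i₀ σ) (vertex σ) j := by
  have h1 := Finset.sum_le_sum fun σ (_ : σ ∈ Finset.univ) =>
    expectedCoordRegret_add_flipSign G U hΔ hT hj σ
  have h2 := Equiv.sum_comp (flipSign_involutive j).toPerm fun σ =>
    expectedCoordRegret G U T (signedParam Δ i₀ σ) (vertex σ) j
  simp only [Function.Involutive.coe_toPerm] at h2
  rw [Finset.sum_add_distrib, h2] at h1
  rw [← Finset.sum_div]
  linarith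

lemma exists_regret_lower_bound {Δ : ℝ} (hΔ : 0 ≤ Δ) (h1 : (d - 1) * Δ ≤ 1) {T : ℕ}
    (hT : T * (2 * Δ) ^ 2 ≤ 1) (i₀ : Fin d) :
    ∃ σ : Fin d → Bool, (d - 1) * (T * Δ / 2) ≤
      ∫ ω, regret G U (signedParam Δ i₀ σ) (vertex σ) T ω ∂law G (gaussianReal 0 1) := by
  have hd : 1 ≤ d := i₀.pos
  have key : ∑ _σ : Fin d → Bool, (d - 1) * (T * Δ / 2) ≤ ∑ σ : Fin d → Bool,
      ∑ j ∈ Finset.univ.erase i₀,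
        expectedCoordRegret G U T (signedParam Δ i₀ σ) (vertex σ) j := by
    rw [Finset.sum_comm]
    calc _ = ∑ j ∈ Finset.univ.erase i₀, ∑ _σ : Fin d → Bool, T * Δ / 2 := by
          simp [Nat.cast_sub hd]
          ring
      _ ≤ _ := Finset.sum_le_sum fun j hj =>
          sum_expectedCoordRegret G U hΔ hT (Finset.ne_of_mem_erase hj)
  obtain ⟨σ, -, hσ⟩ := Finset.exists_le_of_sum_le Finset.univ_nonempty key
  refine ⟨σ, hσ.trans ?_⟩
  rw [integral_regret]
  -- Coordinate `i₀` can be added back: against the optimal vertex every coordinate has nonnegative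
  -- regret.
  refine Finset.sum_le_sum_of_subset_of_nonneg (Finset.erase_subset _ _) fun j _ _ => ?_
  refine Finset.sum_nonneg fun t _ => integral_nonneg fun ω => ?_
  have := signedParam_mul_le hΔ h1 i₀ σ
    (abs_meanCoord_le G j t (seedPast G U (signedParam Δ i₀ σ) t ω)) j
  simp only [coordRegret, Pi.zero_apply, mul_sub]
  linarith

/-- The regret lower bound holds for every user, rational or not. -/
theorem regret_lower_bound (hd : 1 ≤ d) {T : ℕ} (hT : d ^ 2 < T) :
    ∃ θ ∈ l1Sphere d, ∃ aStar ∈ hypercube d, (∀ a ∈ hypercube d, θ ⬝ᵥ a ≤ θ ⬝ᵥ aStar) ∧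
      Integrable (regret G U θ aStar T) (law G (gaussianReal 0 1)) ∧
      Real.exp (-2) / 4 * ((d : ℝ) - 1) * Real.sqrt T ≤
        ∫ ω, regret G U θ aStar T ω ∂law G (gaussianReal 0 1) := by
  have hdT : (d : ℝ) ≤ Real.sqrt T := Real.le_sqrt_of_sq_le (by exact_mod_cast hT.le)
  have hd' : (1 : ℝ) ≤ d := by exact_mod_cast hd
  have hs : 0 < Real.sqrt T := by linarith
  have hss : Real.sqrt T * Real.sqrt T = T := Real.mul_self_sqrt (Nat.cast_nonneg _)
  -- The largest `Δ` with `T (2Δ)² ≤ 1`. As `d ≤ √T`, the mass `(d - 1) Δ` stays below one.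
  set Δ : ℝ := 1 / (2 * Real.sqrt T) with hΔdef
  have hΔs : Δ * Real.sqrt T = 1 / 2 := by rw [hΔdef]; field_simp
  have hΔ : 0 ≤ Δ := by positivity
  have h1 : ((d : ℝ) - 1) * Δ ≤ 1 := by nlinarith
  have hTΔ : (T : ℝ) * Δ = Real.sqrt T / 2 := by
    linear_combination (-Δ) * hss + Real.sqrt T * hΔs
  have h2 : (T : ℝ) * (2 * Δ) ^ 2 ≤ 1 := by
    have : (T : ℝ) * (2 * Δ) ^ 2 = 4 * (T * Δ) * Δ := by ring
    rw [this, hTΔ]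
    linarith
  obtain ⟨σ, hσ⟩ := exists_regret_lower_bound G U hΔ h1 h2 ⟨0, hd⟩
  refine ⟨_, signedParam_mem hΔ h1 ⟨0, hd⟩ σ, _, vertex_mem σ,
    fun a ha => signedParam_isMaxOn hΔ h1 _ σ ha, integrable_regret G U _ _ T, le_trans ?_ hσ⟩
  rw [hTΔ]
  have he : Real.exp (-2) ≤ 1 := Real.exp_le_one_iff.2 (by norm_num)
  have : 0 ≤ ((d : ℝ) - 1) * Real.sqrt T := mul_nonneg (by linarith) hs.le
  nlinarith

end LowerBound

/-! ### Rank-one updates of determinant, inverse and quadratic form -/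

section RankOneUpdate

variable {n : Type*} [Fintype n] [DecidableEq n] {V : Matrix n n ℝ}

lemma dotProduct_inv_mulVec_comm (hV : V.PosDef) (x y : n → ℝ) :
    x ⬝ᵥ (V⁻¹ *ᵥ y) = (V⁻¹ *ᵥ x) ⬝ᵥ y := by
  have h : (V⁻¹)ᵀ = V⁻¹ := by simpa using hV.inv.isHermitian.eq
  rw [dotProduct_mulVec, ← mulVec_transpose, h]

lemma dotProduct_inv_mulVec_nonneg (hV : V.PosDef) (x : n → ℝ) : 0 ≤ x ⬝ᵥ (V⁻¹ *ᵥ x) := by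
  simpa using hV.inv.posSemidef.dotProduct_mulVec_nonneg x

lemma det_add_vecMulVec (hV : V.PosDef) (a : n → ℝ) :
    (V + vecMulVec a a).det = V.det * (1 + a ⬝ᵥ (V⁻¹ *ᵥ a)) := by
  rw [vecMulVec_eq Unit, det_add_replicateCol_mul_replicateRow hV.det_pos.ne'.isUnit]
  congr 2
  rw [dotProduct_mulVec]
  simp [Matrix.mul_apply, dotProduct, vecMul]

/-- The Sherman–Morrison formula. -/
lemma inv_add_vecMulVec (hV : V.PosDef) (a : n → ℝ) : (V + vecMulVec a a)⁻¹ =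
    V⁻¹ - (1 + a ⬝ᵥ (V⁻¹ *ᵥ a))⁻¹ • vecMulVec (V⁻¹ *ᵥ a) (V⁻¹ *ᵥ a) := by
  have hu := dotProduct_inv_mulVec_nonneg hV a
  have hdet : IsUnit V.det := hV.det_pos.ne'.isUnit
  have ht : (V⁻¹)ᵀ = V⁻¹ := by simpa using hV.inv.isHermitian.eq
  refine inv_eq_right_inv ?_
  have e1 : V *ᵥ (V⁻¹ *ᵥ a) = a := by rw [mulVec_mulVec, mul_nonsing_inv _ hdet, one_mulVec]
  have e2 : a ᵥ* V⁻¹ = V⁻¹ *ᵥ a := by rw [← mulVec_transpose, ht]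
  rw [add_mul, mul_sub, mul_sub, mul_nonsing_inv _ hdet, Matrix.mul_smul, Matrix.mul_smul,
    mul_vecMulVec, e1, vecMulVec_mul, e2, vecMulVec_mul_vecMulVec]
  set p := V⁻¹ *ᵥ a
  set u := a ⬝ᵥ p
  ext i j
  simp only [Matrix.add_apply, Matrix.sub_apply, Matrix.smul_apply, vecMulVec_apply,
    Pi.smul_apply, smul_eq_mul]
  have : 1 + u ≠ 0 := by positivity
  field_simp
  ring

/-- Sherman–Morrison, arranged as a quadratic polynomial in the noise `y` so that its Gaussian mean
can be read off. -/
lemma energy_update (hV : V.PosDef) (a : n → ℝ) (w : n → ℝ) (y : ℝ) :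
    (w + y • a) ⬝ᵥ ((V + vecMulVec a a)⁻¹ *ᵥ (w + y • a)) =
      w ⬝ᵥ (V⁻¹ *ᵥ w) - (a ⬝ᵥ (V⁻¹ *ᵥ w)) ^ 2 / (1 + a ⬝ᵥ (V⁻¹ *ᵥ a)) +
        2 * (a ⬝ᵥ (V⁻¹ *ᵥ w) / (1 + a ⬝ᵥ (V⁻¹ *ᵥ a))) * y +
        a ⬝ᵥ (V⁻¹ *ᵥ a) / (1 + a ⬝ᵥ (V⁻¹ *ᵥ a)) * y ^ 2 := by
  have hu := dotProduct_inv_mulVec_nonneg hV a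
  have h1 : (1 + a ⬝ᵥ (V⁻¹ *ᵥ a)) ≠ 0 := by positivity
  have h2 := dotProduct_inv_mulVec_comm hV a w
  have h3 := dotProduct_inv_mulVec_comm hV a a
  have h4 := dotProduct_inv_mulVec_comm hV w a
  have h5 := dotProduct_comm w (V⁻¹ *ᵥ a)
  rw [inv_add_vecMulVec hV]
  simp only [sub_mulVec, smul_mulVec, vecMulVec_mulVec, mulVec_add, mulVec_smul, add_dotProduct,
    smul_dotProduct, dotProduct_add, dotProduct_sub, dotProduct_smul, smul_eq_mul,
    op_smul_eq_smul, h5, ← h2, ← h3]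
  field_simp
  ring

end RankOneUpdate

/-! ### The greedy ridge regression user -/

section Ridge

variable {d : ℕ}

/-- The regularized Gram matrix of the consumed arms. -/
def gram {t : ℕ} (h : UserHistory d t) : Matrix (Fin d) (Fin d) ℝ :=
  1 + ∑ s, vecMulVec (h s).1 (h s).1

/-- The sum of the consumed arms weighted by their rewards. -/
def response {t : ℕ} (h : UserHistory d t) : Arm d := ∑ s, (h s).2 • (h s).1

lemma posDef_gram {t : ℕ} (h : UserHistory d t) : (gram h).PosDef :=
  PosDef.one.add_posSemidef (posSemidef_sum _ fun s _ => by
    simpa using posSemidef_vecMulVec_self_star (h s).1)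

lemma continuous_gram (t : ℕ) : Continuous fun h : UserHistory d t => gram h := by
  refine continuous_const.add (continuous_finsetSum _ fun s _ => ?_)
  exact Continuous.matrix_vecMulVec (by fun_prop) (by fun_prop)

lemma continuous_inv_gram (t : ℕ) : Continuous fun h : UserHistory d t => (gram h)⁻¹ := by
  have h1 : ∀ h : UserHistory d t, (gram h)⁻¹ = (gram h).det⁻¹ • (gram h).adjugate := fun h => by
    rw [Matrix.inv_def, Ring.inverse_eq_inv]
  simp_rw [h1]
  exact ((continuous_gram t).matrix_det.inv₀ fun h => (posDef_gram h).det_pos.ne').smul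
    (continuous_gram t).matrix_adjugate

lemma continuous_response (t : ℕ) : Continuous fun h : UserHistory d t => response h := by
  unfold response
  fun_prop

lemma continuous_ridgeEstimate (t : ℕ) :
    Continuous fun h : UserHistory d t => (gram h)⁻¹ *ᵥ response h :=
  (continuous_inv_gram t).matrix_mulVec (continuous_response t)

/-- The user who estimates by ridge regression and chooses greedily. -/
def ridgeUser (d : ℕ) : User d where
  prior := 1
  posDef_prior := PosDef.one
  estimate t h := (gram h)⁻¹ *ᵥ response h
  measurable_estimate t := (continuous_ridgeEstimate t).measurable
  bonus _ _ _ _ := 0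
  choose t h q := decide (((gram h)⁻¹ *ᵥ response h) ⬝ᵥ q.1 ≤ ((gram h)⁻¹ *ᵥ response h) ⬝ᵥ q.2)
  measurable_choose t := by
    have h := (continuous_ridgeEstimate (d := d) t).measurable
    have hd : ∀ {f g : UserHistory d t × (Arm d × Arm d) → Arm d}, Measurable f → Measurable g →
        Measurable fun p => f p ⬝ᵥ g p := fun hf hg => by
      unfold dotProduct
      fun_prop
    refine measurable_to_bool ?_
    have e : (fun p : UserHistory d t × (Arm d × Arm d) =>
        decide (((gram p.1)⁻¹ *ᵥ response p.1) ⬝ᵥ p.2.1 ≤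
          ((gram p.1)⁻¹ *ᵥ response p.1) ⬝ᵥ p.2.2)) ⁻¹' {true} =
        {p | ((gram p.1)⁻¹ *ᵥ response p.1) ⬝ᵥ p.2.1 ≤
          ((gram p.1)⁻¹ *ᵥ response p.1) ⬝ᵥ p.2.2} := by
      ext p
      simp
    rw [e]
    exact measurableSet_le (hd (h.comp measurable_fst) (by fun_prop))
      (hd (h.comp measurable_fst) (by fun_prop))

lemma ridgeUser_decisionRule (A : Set (Arm d)) : (ridgeUser d).DecisionRule A 0 0 := by
  intro t h q _ _ _
  refine ⟨fun i => by simp [ridgeUser], fun i => ?_⟩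
  by_cases hq : ((gram h)⁻¹ *ᵥ response h) ⬝ᵥ q.1 ≤ ((gram h)⁻¹ *ᵥ response h) ⬝ᵥ q.2
  · cases i <;> simp [User.index, ridgeUser, pick, hq]
  · cases i <;> simp [User.index, ridgeUser, pick, hq, (not_le.1 hq).le]

/-- The accumulated noise, shifted by the prior. -/
def residual (θ : Arm d) {t : ℕ} (h : UserHistory d t) : Arm d := response h - gram h *ᵥ θ

/-- The square of the self-normalized estimation error. -/
def energy (θ : Arm d) {t : ℕ} (h : UserHistory d t) : ℝ :=
  residual θ h ⬝ᵥ ((gram h)⁻¹ *ᵥ residual θ h)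

lemma energy_nonneg (θ : Arm d) {t : ℕ} (h : UserHistory d t) : 0 ≤ energy θ h :=
  dotProduct_inv_mulVec_nonneg (posDef_gram h) _

lemma measurable_energy (θ : Arm d) (t : ℕ) :
    Measurable fun h : UserHistory d t => energy θ h := by
  have hr : Continuous fun h : UserHistory d t => residual θ h :=
    (continuous_response t).sub ((continuous_gram t).matrix_mulVec continuous_const)
  exact (hr.dotProduct ((continuous_inv_gram t).matrix_mulVec hr)).measurable

lemma weightedNorm_ridge (θ : Arm d) {t : ℕ} (h : UserHistory d t) :
    weightedNorm ((ridgeUser d).designMatrix h) (θ - (ridgeUser d).estimate t h) =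
      Real.sqrt (energy θ h) := by
  have hdet : IsUnit (gram h).det := (posDef_gram h).det_pos.ne'.isUnit
  have e1 : θ - (gram h)⁻¹ *ᵥ response h = -((gram h)⁻¹ *ᵥ residual θ h) := by
    rw [residual, mulVec_sub, mulVec_mulVec, nonsing_inv_mul _ hdet, one_mulVec, neg_sub]
  have e2 : gram h *ᵥ ((gram h)⁻¹ *ᵥ residual θ h) = residual θ h := by
    rw [mulVec_mulVec, mul_nonsing_inv _ hdet, one_mulVec]
  change Real.sqrt ((θ - (gram h)⁻¹ *ᵥ response h) ⬝ᵥ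
    (gram h *ᵥ (θ - (gram h)⁻¹ *ᵥ response h))) = _
  rw [e1, mulVec_neg, e2, neg_dotProduct_neg, dotProduct_comm, energy]

lemma gram_snoc {t : ℕ} (h : UserHistory d t) (x : Arm d × ℝ) :
    gram (Fin.snoc (α := fun _ => Arm d × ℝ) h x : UserHistory d (t + 1)) =
      gram h + vecMulVec x.1 x.1 := by
  simp [gram, Fin.sum_univ_castSucc, add_assoc]

/-- The signal `θ ⬝ᵥ a` in the reward cancels against the growth of `gram h *ᵥ θ`, leaving pure
noise. -/
lemma residual_snoc (θ : Arm d) {t : ℕ} (h : UserHistory d t) (a : Arm d) (y : ℝ) :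
    residual θ (Fin.snoc (α := fun _ => Arm d × ℝ) h (a, θ ⬝ᵥ a + y) : UserHistory d (t + 1)) =
      residual θ h + y • a := by
  rw [residual, residual, gram_snoc, add_mulVec, vecMulVec_mulVec]
  simp only [response, Fin.sum_univ_castSucc, Fin.snoc_castSucc, Fin.snoc_last,
    op_smul_eq_smul, dotProduct_comm a θ, add_smul]
  abel

/-- The entries are at most `t + 1` in modulus, and the Leibniz expansion has `d!` terms. This crude
bound suffices because only its logarithm is used. -/
lemma gram_det_le {t : ℕ} {h : UserHistory d t} (hh : ∀ s, (h s).1 ∈ hypercube d) :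
    (gram h).det ≤ d.factorial * ((t : ℝ) + 1) ^ d := by
  have hb : ∀ i j, AbsoluteValue.abs (gram h i j) ≤ (t : ℝ) + 1 := by
    intro i j
    have h1 : |(1 : Matrix (Fin d) (Fin d) ℝ) i j| ≤ 1 := by
      rw [Matrix.one_apply]
      split_ifs <;> simp
    have h2 : |∑ s, (h s).1 i * (h s).1 j| ≤ t := by
      refine (Finset.abs_sum_le_sum_abs _ _).trans ?_
      calc _ ≤ ∑ _s : Fin t, (1 : ℝ) := Finset.sum_le_sum fun s _ => by
            rw [abs_mul]
            exact mul_le_one₀ (abs_le.2 (hh s i)) (abs_nonneg _) (abs_le.2 (hh s j))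
        _ = t := by simp
    simp only [gram, Matrix.add_apply, Matrix.sum_apply, vecMulVec_apply,
      AbsoluteValue.abs_apply]
    linarith [abs_add_le ((1 : Matrix (Fin d) (Fin d) ℝ) i j) (∑ s, (h s).1 i * (h s).1 j)]
  have h3 := det_le hb
  simp only [Fintype.card_fin, nsmul_eq_mul, AbsoluteValue.abs_apply] at h3
  exact (le_abs_self _).trans h3

lemma integral_quadratic_gaussianReal (α β κ : ℝ) :
    Integrable (fun y => α + β * y + κ * y ^ 2) (gaussianReal 0 1) ∧
      ∫ y, (α + β * y + κ * y ^ 2) ∂gaussianReal 0 1 = α + κ := by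
  have hL : MemLp id 2 (gaussianReal 0 1) := memLp_id_gaussianReal' 2 (by simp)
  have h1 : Integrable (fun y : ℝ => y) (gaussianReal 0 1) := hL.integrable (by norm_num)
  have h2 : Integrable (fun y : ℝ => y ^ 2) (gaussianReal 0 1) := hL.integrable_sq
  have hv : ∫ y : ℝ, y ^ 2 ∂gaussianReal 0 1 = 1 := by
    have := variance_of_integral_eq_zero (μ := gaussianReal 0 1) (X := fun y : ℝ => y)
      (by fun_prop) integral_id_gaussianReal
    rw [← this, variance_fun_id_gaussianReal]
    rfl
  have h3 : Integrable (fun y => α + β * y) (gaussianReal 0 1) :=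
    (integrable_const α).add (h1.const_mul β)
  refine ⟨h3.add (h2.const_mul κ), ?_⟩
  rw [integral_add h3 (h2.const_mul κ), integral_add (integrable_const α) (h1.const_mul β),
    integral_const_mul, integral_const_mul, integral_id_gaussianReal, hv]
  simp

variable {A : Set (Arm d)} (G : SystemAlgorithm A) (U : User d) (θ : Arm d)

lemma seedPast_arm_mem (t : ℕ) (ω : G.Seed × (ℕ → ℝ)) (s : Fin t) :
    ((seedPast G U θ t ω).2.2 s).1 ∈ A := by
  induction t with
  | zero => exact s.elim0
  | succ t ih =>
    refine Fin.lastCases ?_ (fun s => ?_) s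
    · simpa [seedPast, play_succ, extend] using consumed_mem G U (seedPast G U θ t ω)
    · simpa [seedPast, play_succ, extend] using ih s

end Ridge

/-! ### Supermartingale bound on the estimation error, and rationality -/

section Potential

variable {d : ℕ} (G : SystemAlgorithm (hypercube d)) (U : User d) (θ : Arm d)

/-- The energy compensated by the logarithm of the determinant of the Gram matrix. -/
def potential (C : ℝ) {t : ℕ} (h : UserHistory d t) : ℝ :=
  energy θ h + (C - Real.log (gram h).det)

lemma measurable_potential (C : ℝ) (t : ℕ) :
    Measurable fun h : UserHistory d t => potential θ C h :=
  (measurable_energy θ t).add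
    (measurable_const.sub (Real.measurable_log.comp (continuous_gram t).matrix_det.measurable))

/-- With `u` the squared norm of `a` for the inverse Gram matrix, the mean energy grows by at most
`u / (1 + u) ≤ log (1 + u)`, and the right side is exactly the growth of the log-determinant. The
constant `C` keeps the potential nonnegative, so `ENNReal.ofReal` truncates nothing. -/
lemma potential_step {C : ℝ} {t : ℕ} (h : UserHistory d t) (a : Arm d)
    (hC : ∀ y, Real.log (gram (Fin.snoc (α := fun _ => Arm d × ℝ) h (a, θ ⬝ᵥ a + y) :
      UserHistory d (t + 1))).det ≤ C) :
    ∫⁻ y, ENNReal.ofReal (potential θ C (Fin.snoc (α := fun _ => Arm d × ℝ) h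
      (a, θ ⬝ᵥ a + y) : UserHistory d (t + 1))) ∂gaussianReal 0 1 ≤
        ENNReal.ofReal (potential θ C h) := by
  have hV := posDef_gram h
  have hu := dotProduct_inv_mulVec_nonneg hV a
  have hpos : ∀ y, 0 ≤ potential θ C (Fin.snoc (α := fun _ => Arm d × ℝ) h
      (a, θ ⬝ᵥ a + y) : UserHistory d (t + 1)) := fun y =>
    add_nonneg (energy_nonneg _ _) (sub_nonneg.2 (hC y))
  have hexp : ∀ y, potential θ C (Fin.snoc (α := fun _ => Arm d × ℝ) h
      (a, θ ⬝ᵥ a + y) : UserHistory d (t + 1)) = _ := fun y => by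
    rw [potential, energy, residual_snoc, gram_snoc, energy_update hV, det_add_vecMulVec hV,
      Real.log_mul hV.det_pos.ne' (by positivity)]
  simp_rw [hexp] at hpos ⊢
  set u := a ⬝ᵥ ((gram h)⁻¹ *ᵥ a)
  set b := a ⬝ᵥ ((gram h)⁻¹ *ᵥ residual θ h)
  have e : ∀ y : ℝ, residual θ h ⬝ᵥ ((gram h)⁻¹ *ᵥ residual θ h) - b ^ 2 / (1 + u) +
      2 * (b / (1 + u)) * y + u / (1 + u) * y ^ 2 +
      (C - (Real.log (gram h).det + Real.log (1 + u))) =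
      (energy θ h - b ^ 2 / (1 + u) + (C - (Real.log (gram h).det + Real.log (1 + u)))) +
      2 * (b / (1 + u)) * y + u / (1 + u) * y ^ 2 := fun y => by
    unfold energy
    ring
  simp_rw [e] at hpos ⊢
  obtain ⟨hi, hv⟩ := integral_quadratic_gaussianReal
    (energy θ h - b ^ 2 / (1 + u) + (C - (Real.log (gram h).det + Real.log (1 + u))))
    (2 * (b / (1 + u))) (u / (1 + u))
  rw [← ofReal_integral_eq_lintegral_ofReal hi (Filter.Eventually.of_forall hpos), hv]
  refine ENNReal.ofReal_le_ofReal ?_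
  have h1 : 0 < 1 + u := by positivity
  have h2 := Real.one_sub_inv_le_log_of_pos h1
  have h3 : u / (1 + u) = 1 - (1 + u)⁻¹ := by field_simp; ring
  have h4 : 0 ≤ b ^ 2 / (1 + u) := by positivity
  unfold potential
  linarith

lemma lintegral_potential_le {C : ℝ} {T : ℕ}
    (hC : ∀ t ≤ T, ∀ h : UserHistory d t, (∀ s, (h s).1 ∈ hypercube d) →
      Real.log (gram h).det ≤ C) {t : ℕ} (ht : t ≤ T) :
    ∫⁻ ω, ENNReal.ofReal (potential θ C (seedPast G U θ t ω).2.2)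
      ∂law G (gaussianReal 0 1) ≤ ENNReal.ofReal (θ ⬝ᵥ θ + C) := by
  induction t with
  -- Without data the Gram matrix is the identity and the residual is `-θ`.
  | zero => simp [potential, energy, residual, response, gram]
  | succ t ih =>
    have hm := measurable_potential θ C (d := d) (t + 1)
    rw [lintegral_seedPast_succ G U θ _ t
      (f := fun z => ENNReal.ofReal (potential θ C z.2.2)) (by fun_prop)]
    refine le_trans (lintegral_mono fun ω => ?_) (ih (by omega))
    refine potential_step θ _ _ fun y => hC _ ht _ fun s => ?_
    refine Fin.lastCases ?_ (fun s => ?_) s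
    · simpa using consumed_mem G U (seedPast G U θ t ω)
    · simpa using seedPast_arm_mem G U θ t ω s

lemma log_det_gram_le {t T : ℕ} (ht : t ≤ T) {h : UserHistory d t}
    (hh : ∀ s, (h s).1 ∈ hypercube d) :
    Real.log (gram h).det ≤ Real.log d.factorial + d * Real.log ((T : ℝ) + 1) := by
  have hf : (0 : ℝ) < d.factorial := by exact_mod_cast d.factorial_pos
  rw [← Real.log_pow, ← Real.log_mul hf.ne' (by positivity)]
  refine Real.log_le_log (posDef_gram h).det_pos ((gram_det_le hh).trans ?_)
  gcongr

lemma lintegral_energy_le (hθ : θ ∈ l1Sphere d) (t : ℕ) :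
    ∫⁻ ω, ENNReal.ofReal (energy θ (seedPast G U θ t ω).2.2) ∂law G (gaussianReal 0 1) ≤
      ENNReal.ofReal (1 + (Real.log d.factorial + d * Real.log ((t : ℝ) + 1))) := by
  refine le_trans (lintegral_mono fun ω => ENNReal.ofReal_le_ofReal ?_)
    ((lintegral_potential_le G U θ (T := t) (fun _ ht _ hh => log_det_gram_le ht hh) le_rfl).trans
      (ENNReal.ofReal_le_ofReal ?_))
  · have := log_det_gram_le (le_refl t) (seedPast_arm_mem G U θ t ω)
    unfold potential
    linarith
  · have h1 : θ ⬝ᵥ θ ≤ ∑ i, |θ i| := Finset.sum_le_sum fun i _ => by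
      have : |θ i| ≤ 1 := by
        rw [← hθ]
        exact Finset.single_le_sum (f := fun i => |θ i|) (fun _ _ => abs_nonneg _)
          (Finset.mem_univ i)
      calc θ i * θ i = |θ i| * |θ i| := (abs_mul_abs_self _).symm
        _ ≤ _ := mul_le_of_le_one_left (abs_nonneg _) this
    rw [hθ] at h1
    linarith

/-- The expected energy grows slower than any power of the number of rounds. -/
def energyConst (d : ℕ) (ρ : ℝ) : ℝ := 1 + Real.log d.factorial + d / (2 * ρ)

lemma energyConst_pos (d : ℕ) {ρ : ℝ} (hρ : 0 < ρ) : 0 < energyConst d ρ := by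
  have : 0 ≤ Real.log d.factorial := Real.log_natCast_nonneg _
  unfold energyConst
  positivity

lemma energy_bound_le (d : ℕ) {ρ : ℝ} (hρ : 0 < ρ) (t : ℕ) :
    1 + (Real.log d.factorial + d * Real.log ((t : ℝ) + 1)) ≤
      energyConst d ρ * (((t : ℝ) + 1) ^ ρ) ^ 2 := by
  have h0 : 0 ≤ Real.log d.factorial := Real.log_natCast_nonneg _
  have ht : (0 : ℝ) < (t : ℝ) + 1 := by positivity
  have h1 := Real.log_le_rpow_div ht.le (show 0 < 2 * ρ by linarith)
  have h2 : ((t : ℝ) + 1) ^ (2 * ρ) = (((t : ℝ) + 1) ^ ρ) ^ 2 := by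
    rw [mul_comm, Real.rpow_mul ht.le, Real.rpow_two]
  have h3 : 1 ≤ (((t : ℝ) + 1) ^ ρ) ^ 2 :=
    one_le_pow₀ (Real.one_le_rpow (by linarith [(Nat.cast_nonneg t : (0 : ℝ) ≤ t)]) hρ.le)
  rw [h2] at h1
  have h4 := mul_le_mul_of_nonneg_left h1 (Nat.cast_nonneg d : (0 : ℝ) ≤ d)
  have h5 : (d : ℝ) * ((((t : ℝ) + 1) ^ ρ) ^ 2 / (2 * ρ)) =
    d / (2 * ρ) * (((t : ℝ) + 1) ^ ρ) ^ 2 := by ring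
  unfold energyConst
  nlinarith

/-- Markov's inequality for the energy. Dividing by `c` inside `g` absorbs all constants, so `c` may
be arbitrarily small. -/
lemma ridgeUser_estimationRule {c ρ : ℝ} (hc : 0 < c) (hρ : 0 < ρ) :
    (ridgeUser d).EstimationRule (hypercube d) (l1Sphere d) (gaussianReal 0 1) c ρ
      (fun δ => Real.sqrt (energyConst d ρ / δ) / c) := by
  rintro θ hθ G t δ ⟨hδ, hδ1⟩
  set P := law G (gaussianReal 0 1)
  set b : ℝ := ((t : ℝ) + 1) ^ ρ with hb
  have hbpos : 0 < b := by positivity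
  have hK := energyConst_pos d hρ
  set e : G.Seed × (ℕ → ℝ) → ℝ := fun ω => energy θ (userHistory G (ridgeUser d) θ t ω)
  have hem : Measurable e := (measurable_energy θ t).comp
    (measurable_snd.comp (measurable_snd.comp (measurable_seedPast G (ridgeUser d) θ t)))
  have hrhs : c * b * (Real.sqrt (energyConst d ρ / δ) / c) =
      Real.sqrt (energyConst d ρ * b ^ 2 / δ) := by
    rw [show energyConst d ρ * b ^ 2 / δ = b ^ 2 * (energyConst d ρ / δ) by ring,
      Real.sqrt_mul (sq_nonneg _), Real.sqrt_sq hbpos.le]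
    field_simp
  simp_rw [weightedNorm_ridge, hrhs]
  set S : Set (G.Seed × (ℕ → ℝ)) := {ω | Real.sqrt (e ω) ≤
    Real.sqrt (energyConst d ρ * b ^ 2 / δ)}
  change ENNReal.ofReal (1 - δ) ≤ P S
  have hM : ENNReal.ofReal (energyConst d ρ * b ^ 2 / δ) * P Sᶜ ≤
      ENNReal.ofReal (energyConst d ρ * b ^ 2) := by
    calc _ ≤ ENNReal.ofReal (energyConst d ρ * b ^ 2 / δ) *
          P {ω | ENNReal.ofReal (energyConst d ρ * b ^ 2 / δ) ≤ ENNReal.ofReal (e ω)} := by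
          gcongr
          intro ω hω
          have : ¬ Real.sqrt (e ω) ≤ Real.sqrt (energyConst d ρ * b ^ 2 / δ) := hω
          exact ENNReal.ofReal_le_ofReal
            (le_of_not_ge fun h => this (Real.sqrt_le_sqrt h))
      _ ≤ ∫⁻ ω, ENNReal.ofReal (e ω) ∂P := mul_meas_ge_le_lintegral hem.ennreal_ofReal _
      _ ≤ _ := (lintegral_energy_le G (ridgeUser d) θ hθ t).trans
          (ENNReal.ofReal_le_ofReal (energy_bound_le d hρ t))
  have hS : P Sᶜ ≤ ENNReal.ofReal δ := by
    have hx : 0 < energyConst d ρ * b ^ 2 / δ := by positivity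
    have h2 : ENNReal.ofReal (energyConst d ρ * b ^ 2) =
        ENNReal.ofReal (energyConst d ρ * b ^ 2 / δ) * ENNReal.ofReal δ := by
      rw [← ENNReal.ofReal_mul hx.le]
      congr 1
      field_simp
    rw [h2] at hM
    exact (ENNReal.mul_le_mul_iff_right (by simpa using hx) ENNReal.ofReal_ne_top).1 hM
  -- Subadditivity is enough here and avoids showing that `S` is measurable.
  have h1 : (1 : ℝ≥0∞) ≤ P S + P Sᶜ := by
    rw [← measure_univ (μ := P), ← Set.union_compl_self S]
    exact measure_union_le _ _
  rw [ENNReal.ofReal_sub _ hδ.le, ENNReal.ofReal_one]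
  exact tsub_le_iff_right.2 (h1.trans (by gcongr))

theorem ridgeUser_isRational (d : ℕ) {c γ : ℝ} (hc : 0 < c) (hγ : 0 < γ) :
    (ridgeUser d).IsRational (hypercube d) (l1Sphere d) (gaussianReal 0 1) c γ := by
  -- The exponent must be positive to dominate the logarithm, at most `γ`, and below `1 / 2`.
  have hρ : 0 < min γ (1 / 4) := by positivity
  refine ⟨c, 0, min γ (1 / 4), 0, _, hc.le, le_rfl, ⟨hρ.le, ?_⟩, by norm_num, ?_, ?_,
    ridgeUser_estimationRule hc hρ, ridgeUser_decisionRule _⟩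
  · exact (min_le_right _ _).trans_lt (by norm_num)
  · exact max_le le_rfl hc.le
  · exact max_le (min_le_left _ _) hγ.le

end Potential

end LearningUser

end

theorem theorem3 (γ : ℝ) (hγ : 0 < γ) :
    ∃ T₀ : ℕ → ℕ, (∀ d, 0 < T₀ d) ∧
      ∀ d : ℕ, 1 ≤ d → ∀ c : ℝ, 0 < c →
        (∃ U : LearningUser.User d,
          U.IsRational (LearningUser.hypercube d) (LearningUser.l1Sphere d)
            (ProbabilityTheory.gaussianReal 0 1) c γ) ∧
        ∀ U : LearningUser.User d,
          U.IsRational (LearningUser.hypercube d) (LearningUser.l1Sphere d)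
            (ProbabilityTheory.gaussianReal 0 1) c γ →
          ∀ T : ℕ, T₀ d < T →
          ∀ G : LearningUser.SystemAlgorithm (LearningUser.hypercube d),
          ∃ θ ∈ LearningUser.l1Sphere d, ∃ aStar ∈ LearningUser.hypercube d,
            (∀ a ∈ LearningUser.hypercube d, θ ⬝ᵥ a ≤ θ ⬝ᵥ aStar) ∧
            MeasureTheory.Integrable (LearningUser.regret G U θ aStar T)
              (LearningUser.law G (ProbabilityTheory.gaussianReal 0 1)) ∧
            Real.exp (-2) / 4 * ((d : ℝ) - 1) * Real.sqrt T ≤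
              ∫ ω, LearningUser.regret G U θ aStar T ω
                ∂(LearningUser.law G (ProbabilityTheory.gaussianReal 0 1)) := by
  refine ⟨fun d => d ^ 2 + 1, fun d => Nat.succ_pos _, fun d hd c hc =>
    ⟨⟨_, LearningUser.ridgeUser_isRational d hc hγ⟩, fun U _ T hT G =>
      LearningUser.regret_lower_bound G U hd ((Nat.lt_succ_self _).trans hT)⟩⟩
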